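/- Let $a<b$, let $k\ge 1$ be an integer, and let $f:[a,b]\to\mathbb R$ be such that $f,f',\dots,f^{(k-1)}$ are absolutely continuous on $[a,b]$ and the derivative $f^{(k)}$, which then exists almost everywhere, coincides almost everywhere with a function $g$ of bounded variation on $[a,b]$. Put $V_k=\mathrm{Var}_{[a,b]}(g)$. Let $G(t)=a+\frac{b-a}{2}(t+1)$, which maps $[-1,1]$ bijectively onto $[a,b]$, let $T_j$ be the Chebyshev polynomials of the first kind, let $t_i=\cos\frac{(2i-1)\pi}{2n}$ for $1\le i\le n$, and put $$c_{j,n}=\frac{2}{n}\sum_{i=1}^{n}f(G(t_i))\,T_j(t_i),\qquad \mathsf C_{d,n}[f](x)=\frac{c_{0,n}}{2}+\sum_{j=1}^{d}c_{j,n}\,T_j(G^{-1}(x)).$$ Let $n$ and $d$ be integers with $n\ge k$ and $k\le d\le 2n-k-1$. Then $$\int_a^b\bigl|f(x)-\mathsf C_{d,n}[f](x)\bigr|\,dx\le \mathbb T_{d,n},$$ where 1. if $d=n-l$ for some $l\in\{1,2,\dots,n-k\}$, $$\mathbb T_{d,n}=\frac{4V_k(b-a)^{k+1}}{4^{k}\,k\,\pi}\sum_{j=0}^{k}\binom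 kj\frac{1}{(n-l+j)(n-l+j-1)\cdots(n-l+j-k+1)};$$ 2. if $d=n+l$ for some $l\in\{0,1,\dots,n-k-1\}$, $$\mathbb T_{d,n}=\frac{6V_k(b-a)^{k+1}}{4^{k}\,k\,\pi}\sum_{j=0}^{k}\binom kj\frac{1}{(n-l+j-1)(n-l+j-2)\cdots(n-l+j-k)}.$$ -/

import Mathlib

open MeasureTheory Set

noncomputable section

/-- The affine bijection `G(t) = a + (b - a)/2 * (t + 1)` of `[-1,1]` onto `[a,b]`. -/
def chebMap (a b t : ℝ) : ℝ := a + (b - a) / 2 * (t + 1)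

/-- The inverse `G⁻¹(x) = 2 (x - a)/(b - a) - 1` of `chebMap a b`. -/
def chebMapInv (a b x : ℝ) : ℝ := 2 * (x - a) / (b - a) - 1

/-- `chebMap a b` is a bijection of `[-1,1]` onto `[a,b]` with inverse `chebMapInv a b`. -/
theorem chebMap_invOn {a b : ℝ} (hab : a < b) :
    InvOn (chebMapInv a b) (chebMap a b) (Icc (-1) 1) (Icc a b) ∧
      BijOn (chebMap a b) (Icc (-1) 1) (Icc a b) := by
  have h0 : (0 : ℝ) < b - a := sub_pos.mpr hab
  have hne : b - a ≠ 0 := h0.ne'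
  have h1 : InvOn (chebMapInv a b) (chebMap a b) (Icc (-1) 1) (Icc a b) := by
    constructor
    · intro t _
      simp only [chebMap, chebMapInv]
      field_simp
      ring
    · intro x _
      simp only [chebMap, chebMapInv]
      field_simp
      ring
  refine ⟨h1, h1.bijOn ?_ ?_⟩
  · rintro t ⟨h2, h3⟩
    simp only [chebMap, mem_Icc]
    constructor <;> nlinarith
  · rintro x ⟨h2, h3⟩
    simp only [chebMapInv, mem_Icc]
    constructor
    · have : 0 ≤ 2 * (x - a) / (b - a) := div_nonneg (by linarith) h0.le
      linarith
    · have : 2 * (x - a) / (b - a) ≤ 2 := (div_le_iff₀ h0).mpr (by nlinarith)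
      linarith

/-- The Chebyshev points `t_l = cos ((2l - 1) π / (2n))`, `l = 1, …, n`. -/
def chebNode (n l : ℕ) : ℝ := Real.cos ((2 * (l : ℝ) - 1) * Real.pi / (2 * (n : ℝ)))

/-- The Chebyshev coefficient computed by `n`-point Gauss–Chebyshev quadrature,
`c_{j,n} = (2/n) ∑_{l=1}^n f(G(t_l)) T_j(t_l)`. -/
def chebCoeffApprox (f : ℝ → ℝ) (a b : ℝ) (n j : ℕ) : ℝ :=
  2 / (n : ℝ) * ∑ l ∈ Finset.Icc 1 n,
    f (chebMap a b (chebNode n l)) * (Polynomial.Chebyshev.T ℝ (j : ℤ)).eval (chebNode n l)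

/-- `C_{d,n}[f](x) = c_{0,n}/2 + ∑_{j=1}^d c_{j,n} T_j(G⁻¹(x))`. -/
def chebPartialSumApprox (f : ℝ → ℝ) (a b : ℝ) (d n : ℕ) (x : ℝ) : ℝ :=
  chebCoeffApprox f a b n 0 / 2 + ∑ j ∈ Finset.Icc 1 d,
    chebCoeffApprox f a b n j * (Polynomial.Chebyshev.T ℝ (j : ℤ)).eval (chebMapInv a b x)

end

/-!
The error of the discrete Chebyshev sum is controlled by the decay of the exact Chebyshev
coefficients `chebCoeff f a b m`, that is, the cosine coefficients of `θ ↦ f (G (cos θ))`.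

*Decay.* One integration by parts in the angle turns the `m`-th coefficient of a function into
`(b - a) / (4 m)` times the difference of the coefficients of its derivative with indices `m - 1`
and `m + 1` (`chebCoeff_succ`). The `m`-th coefficient of a function of bounded variation is at
most `2 V / (π m)` (`abs_chebCoeff_le_of_boundedVariationOn`). After `k` steps the bounds combine
without loss into the reciprocal of the single product
`(m - k) (m - k + 2) ⋯ (m + k) = stepProd (k + 1) m` (`abs_chebCoeff_le`). In particular the
coefficients are summable, so that the Chebyshev series converges to `f` everywhere
(`hasSum_chebCoeff_mul_cos`).

*Aliasing.* The discrete sum is linear in the values of `f`, so its error on `f` is the series of its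
errors on the polynomials `T_m` (`hasSum_mul_aliasError`). By the orthogonality of the cosines on
the nodes, `T_m` is mapped to a combination of the `cos (j θ)` with `|j| ≤ d` and `j ≡ m` modulo
`2 n`, with coefficients of modulus at most one. Hence the error vanishes for `m ≤ d` with
`m + d < 2 n`; otherwise it is at most `2` if the window `|j| ≤ d` is no longer than `2 n`, and at
most `3` if `d < 2 n`. This is the source of the constants `4 = 2 * 2` and `6 = 2 * 3`.

*Summation.* The reciprocals of `stepProd (k + 1) m` telescope in steps of two
(`sum_range_inv_stepProd_le`), and the two boundary terms equal the binomial sum of the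
statement (`sum_choose_div_prod_eq_add`). The resulting bound on the error is uniform, and
integration over `[a, b]` contributes the last factor `b - a`.
-/

/-! ### Products in steps of two -/

/-- The product `(x - k + 1) (x - k + 3) ⋯ (x + k - 1)` of `k` factors in steps of two, centred
at `x`. -/
noncomputable def stepProd (k : ℕ) (x : ℝ) : ℝ := ∏ i ∈ Finset.range k, (x - k + 1 + 2 * i)

theorem stepProd_one (x : ℝ) : stepProd 1 x = x := by simp [stepProd]

theorem stepProd_succ_left (k : ℕ) (x : ℝ) : stepProd (k + 1) x = (x - k) * stepProd k (x + 1) := by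
  rw [stepProd, stepProd, Finset.prod_range_succ', mul_comm]
  congr 1
  · push_cast; ring
  · refine Finset.prod_congr rfl fun i _ => ?_
    push_cast; ring

theorem stepProd_succ_right (k : ℕ) (x : ℝ) :
    stepProd (k + 1) x = stepProd k (x - 1) * (x + k) := by
  rw [stepProd, stepProd, Finset.prod_range_succ]
  congr 1
  · refine Finset.prod_congr rfl fun i _ => ?_
    push_cast; ring
  · push_cast; ring

theorem stepProd_pos {k : ℕ} {x : ℝ} (hx : (k : ℝ) < x + 1) : 0 < stepProd k x := by
  refine Finset.prod_pos fun i _ => ?_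
  have : (0 : ℝ) ≤ i := i.cast_nonneg
  linarith

theorem inv_stepProd_add_inv_stepProd {k : ℕ} {x : ℝ} (hx : (k : ℝ) < x) :
    1 / stepProd k (x - 1) + 1 / stepProd k (x + 1) = 2 * x / stepProd (k + 1) x := by
  have h1 : 0 < stepProd k (x - 1) := stepProd_pos (by linarith)
  have h2 : 0 < stepProd k (x + 1) := stepProd_pos (by linarith)
  have h3 : 0 < x - k := by linarith
  have h4 : 0 < x + k := by have : (0 : ℝ) ≤ k := k.cast_nonneg; linarith
  have e := stepProd_succ_left k x
  have e' := stepProd_succ_right k x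
  rw [eq_div_iff (by rw [e]; positivity), add_mul]
  nth_rw 1 [e']
  rw [e]
  field_simp
  ring

/-- The reciprocals telescope in steps of two. -/
theorem inv_stepProd_sub_inv_stepProd {k : ℕ} {x : ℝ} (hx : (k : ℝ) < x) :
    1 / stepProd k (x - 1) - 1 / stepProd k (x + 1) = 2 * k / stepProd (k + 1) x := by
  have h1 : 0 < stepProd k (x - 1) := stepProd_pos (by linarith)
  have h2 : 0 < stepProd k (x + 1) := stepProd_pos (by linarith)
  have h3 : 0 < x - k := by linarith
  have h4 : 0 < x + k := by have : (0 : ℝ) ≤ k := k.cast_nonneg; linarith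
  have e := stepProd_succ_left k x
  have e' := stepProd_succ_right k x
  rw [eq_div_iff (by rw [e]; positivity), sub_mul]
  nth_rw 1 [e']
  rw [e]
  field_simp
  ring

/-- Pascal's rule under a sum. -/
theorem sum_choose_succ_mul_eq (k : ℕ) (h : ℕ → ℝ) :
    ∑ i ∈ Finset.range (k + 2), ((k + 1).choose i : ℝ) * h i =
      ∑ i ∈ Finset.range (k + 1), (k.choose i : ℝ) * h i +
        ∑ i ∈ Finset.range (k + 1), (k.choose i : ℝ) * h (i + 1) := by
  have := Finset.sum_choose_succ_mul (fun i _ => h i) k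
  rw [this, add_comm]

/-- Partial fractions: a product of `k + 2` consecutive factors splits as a difference. -/
theorem inv_prod_succ_eq {k : ℕ} {y : ℝ} (hy : (k : ℝ) + 1 < y) :
    1 / ∏ r ∈ Finset.range (k + 2), (y - r) =
      1 / (k + 1) * (1 / ∏ r ∈ Finset.range (k + 1), (y - 1 - r) -
        1 / ∏ r ∈ Finset.range (k + 1), (y - r)) := by
  have hpos : ∀ z : ℝ, (k : ℝ) < z → 0 < ∏ r ∈ Finset.range (k + 1), (z - r) := by
    intro z hz
    refine Finset.prod_pos fun r hr => ?_
    have : (r : ℝ) ≤ k := by exact_mod_cast Nat.lt_succ_iff.mp (Finset.mem_range.mp hr)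
    linarith
  have h1 := hpos y (by linarith)
  have h2 := hpos (y - 1) (by linarith)
  have e1 : ∏ r ∈ Finset.range (k + 2), (y - r) =
      (∏ r ∈ Finset.range (k + 1), (y - r)) * (y - (k + 1)) := by
    rw [Finset.prod_range_succ]; push_cast; ring
  have e2 : ∏ r ∈ Finset.range (k + 2), (y - r) =
      (∏ r ∈ Finset.range (k + 1), (y - 1 - r)) * y := by
    rw [Finset.prod_range_succ']
    congr 1
    · refine Finset.prod_congr rfl fun i _ => ?_
      push_cast; ring
    · simp
  have h3 : 0 < y - (k + 1) := by linarith
  have hk : (0 : ℝ) < k + 1 := by positivity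
  have h4 : 0 < y := by linarith
  have e3 : 1 / ∏ r ∈ Finset.range (k + 1), (y - 1 - r) =
      y / ∏ r ∈ Finset.range (k + 2), (y - r) := by rw [e2]; field_simp
  have e4 : 1 / ∏ r ∈ Finset.range (k + 1), (y - r) =
      (y - (k + 1)) / ∏ r ∈ Finset.range (k + 2), (y - r) := by rw [e1]; field_simp
  rw [e3, e4]
  field_simp
  ring

/-- The binomial average of reciprocals of falling products collapses to the reciprocal of a
single product in steps of two. -/
theorem sum_choose_div_prod {k : ℕ} {x : ℝ} (hx : (k : ℝ) < x) :
    ∑ i ∈ Finset.range (k + 1), (k.choose i : ℝ) *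
      (1 / ∏ r ∈ Finset.range (k + 1), (x + i - r)) = 2 ^ k / stepProd (k + 1) x := by
  induction k generalizing x with
  | zero => simp [stepProd]
  | succ k ih =>
    push_cast at hx
    rw [sum_choose_succ_mul_eq, ← Finset.sum_add_distrib]
    have key : ∀ i ∈ Finset.range (k + 1), (k.choose i : ℝ) *
        (1 / ∏ r ∈ Finset.range (k + 1 + 1), (x + i - r)) + (k.choose i : ℝ) *
        (1 / ∏ r ∈ Finset.range (k + 1 + 1), (x + (i + 1 : ℕ) - r)) =
        1 / (k + 1) * ((k.choose i : ℝ) * (1 / ∏ r ∈ Finset.range (k + 1), (x - 1 + i - r))) -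
        1 / (k + 1) * ((k.choose i : ℝ) * (1 / ∏ r ∈ Finset.range (k + 1), (x + 1 + i - r))) := by
      intro i _
      have hi : (0 : ℝ) ≤ i := i.cast_nonneg
      rw [inv_prod_succ_eq (y := x + i) (by linarith),
        inv_prod_succ_eq (y := x + (i + 1 : ℕ)) (by push_cast; linarith)]
      have e1 : x + i - 1 = x - 1 + i := by ring
      have e2 : x + ((i + 1 : ℕ) : ℝ) - 1 = x + i := by push_cast; ring
      have e3 : x + ((i + 1 : ℕ) : ℝ) = x + 1 + i := by push_cast; ring
      rw [e1, e2, e3]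
      ring
    rw [Finset.sum_congr rfl key, Finset.sum_sub_distrib, ← Finset.mul_sum, ← Finset.mul_sum,
      ih (by linarith), ih (by linarith)]
    have h := inv_stepProd_sub_inv_stepProd (k := k + 1) (x := x) (by push_cast; exact hx)
    have hk : (k : ℝ) + 1 ≠ 0 := by positivity
    calc _ = 1 / (k + 1) * 2 ^ k *
          (1 / stepProd (k + 1) (x - 1) - 1 / stepProd (k + 1) (x + 1)) := by ring
      _ = _ := by
        rw [h]
        push_cast
        field_simp
        ring

/-- The sum in the error bound, in closed form. -/
theorem sum_choose_div_prod_eq_add {k : ℕ} (hk : 1 ≤ k) {x : ℝ} (hx : (k : ℝ) ≤ x) :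
    ∑ i ∈ Finset.range (k + 1), (k.choose i : ℝ) *
      (1 / ∏ r ∈ Finset.range k, (x + i - r)) =
      2 ^ k / 2 * (1 / stepProd k x + 1 / stepProd k (x + 1)) := by
  obtain ⟨k, rfl⟩ := Nat.exists_eq_add_of_le' hk
  push_cast at hx
  have h1 := sum_choose_div_prod (k := k) (x := x) (by linarith)
  have h2 := sum_choose_div_prod (k := k) (x := x + 1) (by linarith)
  rw [sum_choose_succ_mul_eq, h1]
  have e : ∀ i : ℕ, x + ((i + 1 : ℕ) : ℝ) = x + 1 + i := fun i => by push_cast; ring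
  simp only [e]
  rw [h2]
  ring

/-- Telescoping in steps of two: the partial sums of the coefficient bounds are dominated by the
two boundary terms. -/
theorem sum_range_inv_stepProd_le {k : ℕ} (hk : 1 ≤ k) {x : ℝ} (hx : (k : ℝ) ≤ x) (N : ℕ) :
    ∑ i ∈ Finset.range N, 1 / stepProd (k + 1) (x + 1 + i) ≤
      1 / (2 * k) * (1 / stepProd k x + 1 / stepProd k (x + 1)) := by
  have hk0 : (0 : ℝ) < k := by exact_mod_cast hk
  have key : ∑ i ∈ Finset.range N, 1 / stepProd (k + 1) (x + 1 + i) =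
      1 / (2 * k) * (1 / stepProd k x + 1 / stepProd k (x + 1)) -
        1 / (2 * k) * (1 / stepProd k (x + N) + 1 / stepProd k (x + 1 + N)) := by
    induction N with
    | zero => simp
    | succ N ih =>
      have hN : (0 : ℝ) ≤ N := N.cast_nonneg
      have h := inv_stepProd_sub_inv_stepProd (k := k) (x := x + 1 + N) (by linarith)
      have h' : 1 / stepProd (k + 1) (x + 1 + N) = 1 / (2 * k) *
          (1 / stepProd k (x + 1 + N - 1) - 1 / stepProd k (x + 1 + N + 1)) := by
        rw [h]; field_simp
      rw [Finset.sum_range_succ, ih, h']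
      have e1 : x + 1 + N - 1 = x + N := by ring
      have e2 : x + ((N + 1 : ℕ) : ℝ) = x + 1 + N := by push_cast; ring
      have e3 : x + 1 + ((N + 1 : ℕ) : ℝ) = x + 1 + N + 1 := by push_cast; ring
      rw [e1, e2, e3]
      ring
  have hN : (0 : ℝ) ≤ N := N.cast_nonneg
  have p1 : 0 < stepProd k (x + N) := stepProd_pos (by linarith)
  have p2 : 0 < stepProd k (x + 1 + N) := stepProd_pos (by linarith)
  rw [key]
  have : 0 ≤ 1 / (2 * (k : ℝ)) * (1 / stepProd k (x + N) + 1 / stepProd k (x + 1 + N)) := by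
    positivity
  linarith

/-! ### Functions of bounded variation -/

theorem BoundedVariationOn.intervalIntegrable_of_le {γ : ℝ → ℝ} {a b : ℝ} (hab : a ≤ b)
    (h : BoundedVariationOn γ (Icc a b)) : IntervalIntegrable γ volume a b := by
  obtain ⟨p, q, hp, hq, rfl⟩ := h.locallyBoundedVariationOn.exists_monotoneOn_sub_monotoneOn
  rw [← uIcc_of_le hab] at hp hq
  exact hp.intervalIntegrable.sub hq.intervalIntegrable

theorem BoundedVariationOn.countable_not_continuousAt {g : ℝ → ℝ} {a b : ℝ}
    (h : BoundedVariationOn g (Icc a b)) : {x ∈ Ioo a b | ¬ ContinuousAt g x}.Countable := by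
  obtain ⟨p, q, hp, hq, rfl⟩ := h.locallyBoundedVariationOn.exists_monotoneOn_sub_monotoneOn
  refine (hp.countable_not_continuousWithinAt.union hq.countable_not_continuousWithinAt).mono ?_
  rintro x ⟨hx, hc⟩
  by_contra hn
  have hn' : x ∈ Icc a b := Ioo_subset_Icc_self hx
  simp only [mem_union, mem_ofPred_eq, hn', true_and, not_or, not_not] at hn
  have hnhds := Icc_mem_nhds hx.1 hx.2
  exact hc ((hn.1.continuousAt hnhds).sub (hn.2.continuousAt hnhds))

/-- Approximate integration by parts on a short interval, for an integrand of bounded variation: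
replacing `γ` by its value at the left endpoint costs at most its variation times the length. -/
theorem abs_integral_mul_deriv_sub_le {γ s s' : ℝ → ℝ} {x y c : ℝ} (hxy : x ≤ y)
    (hγ : BoundedVariationOn γ (Icc x y)) (hs : ∀ t, HasDerivAt s (s' t) t)
    (hs' : Continuous s') (hs1 : ∀ t, |s' t| ≤ 1) (hsc : ∀ t, |s t| ≤ c) :
    |(∫ t in x..y, γ t * s' t) - (γ y * s y - γ x * s x)| ≤
      (eVariationOn γ (Icc x y)).toReal * (y - x + c) := by
  set v := (eVariationOn γ (Icc x y)).toReal
  have hx : x ∈ Icc x y := left_mem_Icc.mpr hxy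
  have hy : y ∈ Icc x y := right_mem_Icc.mpr hxy
  have hint : IntervalIntegrable (fun t => γ t * s' t) volume x y :=
    (hγ.intervalIntegrable_of_le hxy).mul_continuousOn hs'.continuousOn
  have hint' : IntervalIntegrable (fun t => γ x * s' t) volume x y :=
    (continuous_const.mul hs').intervalIntegrable _ _
  have hftc : ∫ t in x..y, γ x * s' t = γ x * (s y - s x) := by
    rw [intervalIntegral.integral_const_mul, intervalIntegral.integral_eq_sub_of_hasDerivAt
      (fun t _ => hs t) (hs'.intervalIntegrable _ _)]
  have e : (∫ t in x..y, γ t * s' t) - (γ y * s y - γ x * s x) =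
      (∫ t in x..y, (γ t - γ x) * s' t) - (γ y - γ x) * s y := by
    simp only [sub_mul]
    rw [intervalIntegral.integral_sub hint hint', hftc]
    ring
  have h1 : |∫ t in x..y, (γ t - γ x) * s' t| ≤ v * (y - x) := by
    have := intervalIntegral.norm_integral_le_of_norm_le_const (a := x) (b := y) (C := v)
      (f := fun t => (γ t - γ x) * s' t) (fun t ht => by
        rw [uIoc_of_le hxy] at ht
        rw [norm_mul, Real.norm_eq_abs, Real.norm_eq_abs]
        have h2 : |γ t - γ x| ≤ v := hγ.dist_le (Ioc_subset_Icc_self ht) hx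
        calc _ ≤ v * 1 := mul_le_mul h2 (hs1 t) (abs_nonneg _) ((abs_nonneg _).trans h2)
          _ = v := mul_one v)
    rwa [Real.norm_eq_abs, abs_of_nonneg (sub_nonneg.mpr hxy)] at this
  have h2 : |(γ y - γ x) * s y| ≤ v * c := by
    rw [abs_mul]
    have h2 : |γ y - γ x| ≤ v := hγ.dist_le hy hx
    exact mul_le_mul h2 (hsc y) (abs_nonneg _) ((abs_nonneg _).trans h2)
  rw [e, mul_add]
  exact (abs_sub _ _).trans (add_le_add h1 h2)

/-- Integration by parts against a function of bounded variation, as an estimate with the sharp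
constant: no Stieltjes integral is needed, since the estimate on short intervals can be summed
over finer and finer subdivisions. -/
theorem abs_integral_mul_deriv_le {γ s s' : ℝ → ℝ} {a b c : ℝ} (hab : a ≤ b)
    (hγ : BoundedVariationOn γ (Icc a b)) (hs : ∀ t, HasDerivAt s (s' t) t)
    (hs' : Continuous s') (hs1 : ∀ t, |s' t| ≤ 1) (hsc : ∀ t, |s t| ≤ c)
    (ha : s a = 0) (hb : s b = 0) :
    |∫ t in a..b, γ t * s' t| ≤ (eVariationOn γ (Icc a b)).toReal * c := by
  set v := (eVariationOn γ (Icc a b)).toReal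
  have key : ∀ N : ℕ, |∫ t in a..b, γ t * s' t| ≤ v * ((b - a) * (1 / ((N : ℝ) + 1)) + c) := by
    intro N
    -- Subdivision into `N + 1` intervals of length `h`.
    set h : ℝ := (b - a) * (1 / ((N : ℝ) + 1)) with hh
    have hN : (0 : ℝ) < (N : ℝ) + 1 := by positivity
    have h0 : 0 ≤ h := mul_nonneg (sub_nonneg.mpr hab) (by positivity)
    set u : ℕ → ℝ := fun i => a + i * h with hu
    have hmono : Monotone u := fun i j hij => by
      have : (i : ℝ) ≤ j := by exact_mod_cast hij
      simp only [hu]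
      gcongr
    have hu0 : u 0 = a := by simp [hu]
    have huN : u (N + 1) = b := by
      simp only [hu, hh]
      push_cast
      field_simp
      ring
    have hstep : ∀ i, u (i + 1) - u i = h := fun i => by simp only [hu]; push_cast; ring
    have hle : ∀ i, u i ≤ u (i + 1) := fun i => hmono (Nat.le_succ i)
    have hsub : ∀ i < N + 1, Icc (u i) (u (i + 1)) ⊆ Icc a b := fun i hi =>
      Icc_subset_Icc (hu0 ▸ hmono (Nat.zero_le i)) (huN ▸ hmono (by omega))
    have hbv : ∀ i < N + 1, BoundedVariationOn γ (Icc (u i) (u (i + 1))) :=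
      fun i hi => hγ.mono (hsub i hi)
    have hsum : ∑ i ∈ Finset.range (N + 1), ∫ t in u i..u (i + 1), γ t * s' t =
        ∫ t in a..b, γ t * s' t := by
      rw [intervalIntegral.sum_integral_adjacent_intervals, hu0, huN]
      exact fun i hi => ((hbv i hi).intervalIntegrable_of_le (hle i)).mul_continuousOn
        hs'.continuousOn
    have htel : ∑ i ∈ Finset.range (N + 1), (γ (u (i + 1)) * s (u (i + 1)) - γ (u i) * s (u i)) =
        0 := by
      rw [Finset.sum_range_sub (fun i => γ (u i) * s (u i)), hu0, huN, ha, hb]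
      simp
    have hvar : ∑ i ∈ Finset.range (N + 1), (eVariationOn γ (Icc (u i) (u (i + 1)))).toReal = v := by
      rw [← ENNReal.toReal_sum (fun i hi => hbv i (Finset.mem_range.mp hi)),
        eVariationOn.sum' γ hmono, hu0, huN]
    calc |∫ t in a..b, γ t * s' t|
        = |∑ i ∈ Finset.range (N + 1), ((∫ t in u i..u (i + 1), γ t * s' t) -
            (γ (u (i + 1)) * s (u (i + 1)) - γ (u i) * s (u i)))| := by
          rw [Finset.sum_sub_distrib, hsum, htel, sub_zero]
      _ ≤ ∑ i ∈ Finset.range (N + 1),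
            (eVariationOn γ (Icc (u i) (u (i + 1)))).toReal * (h + c) := by
          refine (Finset.abs_sum_le_sum_abs _ _).trans (Finset.sum_le_sum fun i hi => ?_)
          rw [← hstep i]
          exact abs_integral_mul_deriv_sub_le (hle i) (hbv i (Finset.mem_range.mp hi)) hs hs' hs1 hsc
      _ = v * (h + c) := by rw [← Finset.sum_mul, hvar]
  have hlim : Filter.Tendsto (fun N : ℕ => v * ((b - a) * (1 / ((N : ℝ) + 1)) + c)) Filter.atTop
      (nhds (v * ((b - a) * 0 + c))) :=
    ((tendsto_one_div_add_atTop_nhds_zero_nat.const_mul (b - a)).add_const c).const_mul v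
  rw [mul_zero, zero_add] at hlim
  exact ge_of_tendsto' hlim key

/-! ### Decay of the Chebyshev coefficients -/

/-- The Chebyshev coefficient `(2/π) ∫₀^π v(G(cos θ)) cos (m θ) dθ` of `v` on `[a, b]`. -/
noncomputable def chebCoeff (v : ℝ → ℝ) (a b : ℝ) (m : ℕ) : ℝ :=
  2 / Real.pi * ∫ θ in (0 : ℝ)..Real.pi, v (chebMap a b (Real.cos θ)) * Real.cos (m * θ)

theorem chebMap_cos_mem_Icc {a b : ℝ} (hab : a < b) (θ : ℝ) :
    chebMap a b (Real.cos θ) ∈ Icc a b :=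
  (chebMap_invOn hab).2.mapsTo ⟨Real.neg_one_le_cos θ, Real.cos_le_one θ⟩

theorem continuous_chebMap_cos (a b : ℝ) : Continuous fun θ => chebMap a b (Real.cos θ) := by
  unfold chebMap
  fun_prop

theorem antitoneOn_chebMap_cos {a b : ℝ} (hab : a < b) :
    AntitoneOn (fun θ => chebMap a b (Real.cos θ)) (Icc 0 Real.pi) := by
  intro x hx y hy hxy
  have h := Real.strictAntiOn_cos.antitoneOn hx hy hxy
  have h0 : 0 ≤ (b - a) / 2 := by linarith
  simp only [chebMap]
  gcongr

theorem eVariationOn_comp_chebMap_cos_le {a b : ℝ} (hab : a < b) (g : ℝ → ℝ) :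
    eVariationOn (fun θ => g (chebMap a b (Real.cos θ))) (Icc 0 Real.pi) ≤
      eVariationOn g (Icc a b) :=
  eVariationOn.comp_le_of_antitoneOn g _ (antitoneOn_chebMap_cos hab)
    fun θ _ => chebMap_cos_mem_Icc hab θ

theorem BoundedVariationOn.comp_chebMap_cos {a b : ℝ} (hab : a < b) {g : ℝ → ℝ}
    (hg : BoundedVariationOn g (Icc a b)) :
    BoundedVariationOn (fun θ => g (chebMap a b (Real.cos θ))) (Icc 0 Real.pi) :=
  ((eVariationOn_comp_chebMap_cos_le hab g).trans_lt hg.lt_top).ne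

theorem abs_chebCoeff_le_of_boundedVariationOn {a b : ℝ} (hab : a < b) {g : ℝ → ℝ}
    (hg : BoundedVariationOn g (Icc a b)) {m : ℕ} (hm : m ≠ 0) :
    |chebCoeff g a b m| ≤ 2 / Real.pi * (eVariationOn g (Icc a b)).toReal / m := by
  have hm' : (0 : ℝ) < m := by positivity
  have h := abs_integral_mul_deriv_le (s := fun t => Real.sin (m * t) / m)
    (s' := fun t => Real.cos (m * t)) (c := 1 / m) Real.pi_pos.le (hg.comp_chebMap_cos hab)
    (fun t => by
      have := ((hasDerivAt_id t).const_mul (m : ℝ)).sin.div_const (m : ℝ)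
      simpa [mul_div_assoc, hm'.ne'] using this)
    (by fun_prop) (fun t => Real.abs_cos_le_one _)
    (fun t => by
      rw [abs_div, abs_of_pos hm']
      exact div_le_div_of_nonneg_right (Real.abs_sin_le_one _) hm'.le)
    (by simp) (by simp [Real.sin_nat_mul_pi])
  have hv : (eVariationOn (fun θ => g (chebMap a b (Real.cos θ))) (Icc 0 Real.pi)).toReal ≤
      (eVariationOn g (Icc a b)).toReal :=
    ENNReal.toReal_mono hg (eVariationOn_comp_chebMap_cos_le hab g)
  have hpi : 0 < 2 / Real.pi := by positivity
  rw [chebCoeff, abs_mul, abs_of_pos hpi, mul_div_assoc]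
  refine mul_le_mul_of_nonneg_left (h.trans ?_) hpi.le
  rw [mul_one_div]
  gcongr

/-- Integration by parts in the angle. The derivative may fail to exist on a countable set. -/
theorem chebCoeff_succ {a b : ℝ} (hab : a < b) {v w : ℝ → ℝ} (hv : ContinuousOn v (Icc a b))
    {s : Set ℝ} (hs : s.Countable) (hd : ∀ x ∈ Ioo a b \ s, HasDerivAt v (w x) x)
    (hw : IntervalIntegrable (fun θ => w (chebMap a b (Real.cos θ))) volume 0 Real.pi) (m : ℕ) :
    chebCoeff v a b (m + 1) =
      (b - a) / (4 * (m + 1)) * (chebCoeff w a b m - chebCoeff w a b (m + 2)) := by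
  have hm : (0 : ℝ) < m + 1 := by positivity
  have hcos (j : ℝ) : Continuous fun θ : ℝ => Real.cos (j * θ) := by fun_prop
  have hsin (j : ℝ) : Continuous fun θ : ℝ => Real.sin (j * θ) := by fun_prop
  have hvc : Continuous fun θ => v (chebMap a b (Real.cos θ)) :=
    hv.comp_continuous (continuous_chebMap_cos a b) (chebMap_cos_mem_Icc hab)
  have hwi (j : ℝ) : IntervalIntegrable
      (fun θ => w (chebMap a b (Real.cos θ)) * Real.cos (j * θ)) volume 0 Real.pi :=
    hw.mul_continuousOn (hcos j).continuousOn
  have hvi (j : ℝ) : IntervalIntegrable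
      (fun θ => v (chebMap a b (Real.cos θ)) * Real.cos (j * θ)) volume 0 Real.pi :=
    (hvc.mul (hcos j)).intervalIntegrable _ _
  have hGinj : InjOn (fun θ => chebMap a b (Real.cos θ)) (Ioo 0 Real.pi) := by
    intro x hx y hy hxy
    refine Real.injOn_cos (Ioo_subset_Icc_self hx) (Ioo_subset_Icc_self hy) ?_
    exact (chebMap_invOn hab).2.injOn ⟨Real.neg_one_le_cos x, Real.cos_le_one x⟩
      ⟨Real.neg_one_le_cos y, Real.cos_le_one y⟩ hxy
  have hcount : (Ioo 0 Real.pi ∩ (fun θ => chebMap a b (Real.cos θ)) ⁻¹' s).Countable := by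
    exact MapsTo.countable_of_injOn (f := fun θ => chebMap a b (Real.cos θ))
      (fun θ hθ => hθ.2) (hGinj.mono inter_subset_left) hs
  have hv' : ∀ θ ∈ Ioo 0 Real.pi \ (Ioo 0 Real.pi ∩ (fun θ => chebMap a b (Real.cos θ)) ⁻¹' s),
      HasDerivAt (fun θ => v (chebMap a b (Real.cos θ)))
        (w (chebMap a b (Real.cos θ)) * ((b - a) / 2 * -Real.sin θ)) θ := by
    rintro θ ⟨hθ, hθs⟩
    have hns : chebMap a b (Real.cos θ) ∉ s := fun h => hθs ⟨hθ, h⟩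
    have hmem : chebMap a b (Real.cos θ) ∈ Ioo a b := by
      have h1 : -1 < Real.cos θ := by
        have := Real.strictAntiOn_cos (Ioo_subset_Icc_self hθ) (right_mem_Icc.mpr Real.pi_pos.le) hθ.2
        rwa [Real.cos_pi] at this
      have h2 : Real.cos θ < 1 := by
        have := Real.strictAntiOn_cos (left_mem_Icc.mpr Real.pi_pos.le) (Ioo_subset_Icc_self hθ) hθ.1
        rwa [Real.cos_zero] at this
      simp only [chebMap, mem_Ioo]
      constructor <;> nlinarith
    have hG : HasDerivAt (fun θ => chebMap a b (Real.cos θ)) ((b - a) / 2 * -Real.sin θ) θ :=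
      (((Real.hasDerivAt_cos θ).add_const 1).const_mul ((b - a) / 2)).const_add a
    exact (hd _ ⟨hmem, hns⟩).comp θ hG
  have hparts := integral_eq_of_hasDerivAt_off_countable_of_le
    (fun θ => v (chebMap a b (Real.cos θ)) * (Real.sin ((m + 1) * θ) / (m + 1)))
    (fun θ => v (chebMap a b (Real.cos θ)) * Real.cos (((m + 1 : ℕ) : ℝ) * θ) -
      (b - a) / (4 * (m + 1)) * (w (chebMap a b (Real.cos θ)) * Real.cos (m * θ) -
        w (chebMap a b (Real.cos θ)) * Real.cos (((m + 2 : ℕ) : ℝ) * θ)))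
    Real.pi_pos.le hcount (hvc.mul ((hsin _).div_const _)).continuousOn
    (fun θ hθ => by
      have hS : HasDerivAt (fun θ : ℝ => Real.sin ((m + 1) * θ) / (m + 1))
          (Real.cos ((m + 1) * θ)) θ := by
        have := ((hasDerivAt_id θ).const_mul ((m : ℝ) + 1)).sin.div_const ((m : ℝ) + 1)
        simpa [mul_div_assoc, hm.ne'] using this
      refine ((hv' θ hθ).mul hS).congr_deriv ?_
      have e1 : Real.cos (m * θ) = Real.cos ((m + 1) * θ) * Real.cos θ +
          Real.sin ((m + 1) * θ) * Real.sin θ := by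
        rw [← Real.cos_sub]; congr 1; ring
      have e2 : Real.cos (((m + 2 : ℕ) : ℝ) * θ) = Real.cos ((m + 1) * θ) * Real.cos θ -
          Real.sin ((m + 1) * θ) * Real.sin θ := by
        rw [← Real.cos_add]; congr 1; push_cast; ring
      rw [e1, e2]
      push_cast
      field_simp
      ring)
    ((hvi _).sub (((hwi _).sub (hwi _)).const_mul _))
  have hend : Real.sin (((m : ℝ) + 1) * Real.pi) = 0 := by
    have := Real.sin_nat_mul_pi (m + 1)
    push_cast at this
    exact this
  rw [intervalIntegral.integral_sub (hvi _)
    (((hwi _).sub (hwi _)).const_mul _), intervalIntegral.integral_const_mul,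
    intervalIntegral.integral_sub (hwi _) (hwi _), hend] at hparts
  simp only [mul_zero, Real.sin_zero, zero_div, sub_self] at hparts
  rw [chebCoeff, chebCoeff, chebCoeff, sub_eq_zero.mp hparts]
  ring

/-- Coefficient decay: `k` integrations by parts and the bounded variation estimate. The two
neighbouring bounds for the derivative combine exactly by `inv_stepProd_add_inv_stepProd`. -/
theorem abs_chebCoeff_le {a b : ℝ} (hab : a < b) (k : ℕ) (v : ℕ → ℝ → ℝ)
    (hc : ∀ i < k, ContinuousOn (v i) (Icc a b))
    (hd : ∀ i < k, ∃ s : Set ℝ, s.Countable ∧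
      ∀ x ∈ Ioo a b \ s, HasDerivAt (v i) (v (i + 1) x) x)
    (hbv : BoundedVariationOn (v k) (Icc a b)) {m : ℕ} (hm : k < m) :
    |chebCoeff (v 0) a b m| ≤ 2 / Real.pi * ((b - a) / 2) ^ k *
      (eVariationOn (v k) (Icc a b)).toReal * (1 / stepProd (k + 1) m) := by
  induction k generalizing v m with
  | zero =>
    simpa [stepProd_one, div_eq_mul_inv] using
      abs_chebCoeff_le_of_boundedVariationOn hab hbv (by omega : m ≠ 0)
  | succ k ih =>
    obtain ⟨m, rfl⟩ : ∃ m', m = m' + 1 := ⟨m - 1, by omega⟩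
    set V := (eVariationOn (v (k + 1)) (Icc a b)).toReal
    have hint : IntervalIntegrable (fun θ => v 1 (chebMap a b (Real.cos θ))) volume 0 Real.pi := by
      rcases Nat.eq_zero_or_pos k with rfl | hk
      · exact (hbv.comp_chebMap_cos hab).intervalIntegrable_of_le Real.pi_pos.le
      · exact ((hc 1 (by omega)).comp_continuous (continuous_chebMap_cos a b)
          (chebMap_cos_mem_Icc hab)).intervalIntegrable _ _
    have ih' := fun {j : ℕ} (hj : k < j) => ih (fun i => v (i + 1))
      (fun i hi => hc (i + 1) (by omega)) (fun i hi => hd (i + 1) (by omega)) hbv hj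
    obtain ⟨s, hs, hd0⟩ := hd 0 (by omega)
    have hba : 0 < b - a := sub_pos.mpr hab
    have h1 := ih' (j := m) (by omega)
    have h2 := ih' (j := m + 2) (by omega)
    simp only [zero_add] at h1 h2
    have hkm : ((k + 1 : ℕ) : ℝ) < ((m + 1 : ℕ) : ℝ) := by exact_mod_cast hm
    have h3 := inv_stepProd_add_inv_stepProd hkm
    have e1 : ((m + 1 : ℕ) : ℝ) - 1 = m := by push_cast; ring
    have e2 : ((m + 1 : ℕ) : ℝ) + 1 = ((m + 2 : ℕ) : ℝ) := by push_cast; ring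
    rw [e1, e2] at h3
    have hm' : (0 : ℝ) < m + 1 := by positivity
    rw [chebCoeff_succ hab (hc 0 (by omega)) hs hd0 hint, abs_mul,
      abs_of_pos (by positivity : 0 < (b - a) / (4 * ((m : ℝ) + 1)))]
    calc _ ≤ (b - a) / (4 * ((m : ℝ) + 1)) *
          (2 / Real.pi * ((b - a) / 2) ^ k * V * (1 / stepProd (k + 1) m) +
          2 / Real.pi * ((b - a) / 2) ^ k * V * (1 / stepProd (k + 1) (m + 2 : ℕ))) := by
          gcongr
          exact (abs_sub _ _).trans (add_le_add h1 h2)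
      _ = (b - a) / (4 * ((m : ℝ) + 1)) * (2 / Real.pi * ((b - a) / 2) ^ k * V) *
          (1 / stepProd (k + 1) m + 1 / stepProd (k + 1) (m + 2 : ℕ)) := by ring
      _ = _ := by
        rw [h3]
        push_cast
        field_simp
        ring

/-- An absolutely continuous function is differentiable at the continuity points of any version
of its derivative. -/
theorem AbsolutelyContinuousOnInterval.hasDerivAt_of_continuousAt {a b : ℝ} {u w : ℝ → ℝ}
    (hu : AbsolutelyContinuousOnInterval u a b)
    (hw : w =ᵐ[volume.restrict (Icc a b)] derivWithin u (Icc a b)) {x : ℝ} (hx : x ∈ Ioo a b)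
    (hc : ContinuousAt w x) : HasDerivAt u (w x) x := by
  have hab : a < b := hx.1.trans hx.2
  have hae : w =ᵐ[volume.restrict (Ioc a b)] deriv u := by
    rw [← restrict_Ioo_eq_restrict_Ioc]
    filter_upwards [ae_restrict_of_ae_restrict_of_subset Ioo_subset_Icc_self hw,
      ae_restrict_mem measurableSet_Ioo] with y hy hy'
    rw [hy, derivWithin_of_mem_nhds (Icc_mem_nhds hy'.1 hy'.2)]
  have hint : IntervalIntegrable w volume a b := by
    refine hu.intervalIntegrable_deriv.congr_ae ?_
    rw [uIoc_of_le hab.le]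
    exact hae.symm
  have hsub : ∀ y ∈ Ioo a b, Ioc a y ⊆ Ioc a b := fun y hy => Ioc_subset_Ioc_right hy.2.le
  have hftc : ∀ y ∈ Ioo a b, u y = u a + ∫ t in a..y, w t := by
    intro y hy
    have h1 : AbsolutelyContinuousOnInterval u a y := hu.mono (by
      rw [uIcc_of_le hy.1.le, uIcc_of_le hab.le]
      exact Icc_subset_Icc_right hy.2.le)
    have h2 : ∫ t in a..y, w t = ∫ t in a..y, deriv u t := by
      refine intervalIntegral.integral_congr_ae_restrict ?_
      rw [uIoc_of_le hy.1.le]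
      exact ae_restrict_of_ae_restrict_of_subset (hsub y hy) hae
    rw [h2, h1.integral_deriv_eq_sub]
    ring
  have hmeas : StronglyMeasurableAtFilter w (nhds x) volume :=
    ⟨Ioc a b, Ioc_mem_nhds hx.1 hx.2, hint.1.aestronglyMeasurable⟩
  have hder := (intervalIntegral.integral_hasDerivAt_right (hint.mono_set (by
    rw [uIcc_of_le hx.1.le, uIcc_of_le hab.le]
    exact Icc_subset_Icc_right hx.2.le)) hmeas hc).const_add (u a)
  refine hder.congr_of_eventuallyEq ?_
  filter_upwards [Ioo_mem_nhds hx.1 hx.2] with y hy using hftc y hy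

/-! ### Cosine series -/

/-- Pointwise convergence of an absolutely summable cosine series. -/
theorem hasSum_cos_series {F : ℝ → ℝ} (hF : Continuous F) (hper : Function.Periodic F (2 * Real.pi))
    (heven : ∀ x, F (-x) = F x) {A : ℕ → ℝ}
    (hA : ∀ m : ℕ, A m = 2 / Real.pi * ∫ θ in (0 : ℝ)..Real.pi, F θ * Real.cos (m * θ))
    (hsum : Summable A) (θ : ℝ) :
    HasSum (fun m : ℕ => (if m = 0 then A 0 / 2 else A m) * Real.cos (m * θ)) (F θ) := by
  have : Fact (0 < 2 * Real.pi) := ⟨by positivity⟩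
  have hper' : Function.Periodic (fun x => (F x : ℂ)) (2 * Real.pi) := fun x => by
    simp [hper x]
  let Φ : C(AddCircle (2 * Real.pi), ℂ) :=
    ⟨hper'.lift, continuous_coinduced_dom.mpr (Complex.continuous_ofReal.comp hF)⟩
  have hΦ : ∀ x : ℝ, Φ (x : AddCircle (2 * Real.pi)) = (F x : ℂ) := fun x => hper'.lift_coe x
  have hfour : ∀ (n : ℤ) (x : ℝ), fourier n (x : AddCircle (2 * Real.pi)) =
      Complex.exp (n * x * Complex.I) := by
    intro n x
    rw [fourier_coe_apply]
    congr 1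
    push_cast
    have : (Real.pi : ℂ) ≠ 0 := by exact_mod_cast Real.pi_ne_zero
    field_simp
  have hcoef : ∀ n : ℤ, fourierCoeff Φ n = ((A n.natAbs / 2 : ℝ) : ℂ) := by
    intro n
    have hcont : Continuous fun x : ℝ => Complex.exp (((-n : ℤ) : ℂ) * x * Complex.I) * (F x : ℂ) :=
      by fun_prop
    have hneg : ∫ x in (-Real.pi)..0, Complex.exp (((-n : ℤ) : ℂ) * x * Complex.I) * (F x : ℂ) =
        ∫ x in (0 : ℝ)..Real.pi, Complex.exp (n * x * Complex.I) * (F x : ℂ) := by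
      have := intervalIntegral.integral_comp_neg (a := 0) (b := Real.pi)
        fun x : ℝ => Complex.exp (((-n : ℤ) : ℂ) * x * Complex.I) * (F x : ℂ)
      rw [neg_zero] at this
      rw [← this]
      refine intervalIntegral.integral_congr fun x _ => ?_
      simp [heven x]
    have hadd : ∀ x : ℝ, Complex.exp (n * x * Complex.I) * (F x : ℂ) +
        Complex.exp (((-n : ℤ) : ℂ) * x * Complex.I) * (F x : ℂ) =
        ((2 * (F x * Real.cos (n.natAbs * x)) : ℝ) : ℂ) := by
      intro x
      have : Real.cos (n.natAbs * x) = Real.cos (n * x) := by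
        rcases Int.natAbs_eq n with h | h
        · conv_rhs => rw [h]
          simp
        · conv_rhs => rw [h]
          simp
      rw [this, ← add_mul]
      push_cast
      rw [Complex.cos]
      ring_nf
    rw [fourierCoeff_eq_intervalIntegral Φ n (-Real.pi)]
    have hend : -Real.pi + 2 * Real.pi = Real.pi := by ring
    simp only [hΦ, hfour, hend, smul_eq_mul]
    rw [← intervalIntegral.integral_add_adjacent_intervals (hcont.intervalIntegrable _ 0)
      (hcont.intervalIntegrable _ _), hneg, ← intervalIntegral.integral_add
      ((by fun_prop : Continuous fun x : ℝ =>
        Complex.exp (n * x * Complex.I) * (F x : ℂ)).intervalIntegrable _ _)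
      (hcont.intervalIntegrable _ _), intervalIntegral.integral_congr (fun x _ => hadd x),
      intervalIntegral.integral_ofReal, intervalIntegral.integral_const_mul, hA,
      Complex.real_smul, ← Complex.ofReal_mul]
    congr 1
    field_simp
  have hS : Summable (fourierCoeff Φ) := by
    have h1 : Summable fun m : ℕ => ((A m / 2 : ℝ) : ℂ) :=
      Complex.summable_ofReal.mpr (hsum.div_const 2)
    refine Summable.of_nat_of_neg ?_ ?_ <;> simpa [hcoef] using h1
  have h := (has_pointwise_sum_fourier_series_of_summable hS
    (θ : AddCircle (2 * Real.pi))).nat_add_neg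
  -- Pairing `m` with `-m` counts the index `0` twice.
  have h0 : HasSum (fun m : ℕ => A m * Real.cos (m * θ)) (F θ + A 0 / 2) := by
    rw [← Complex.hasSum_ofReal]
    convert h using 1
    · ext m
      rw [hcoef, hcoef, hfour, hfour, Int.natAbs_neg, Int.natAbs_natCast]
      simp only [smul_eq_mul]
      push_cast
      rw [Complex.cos]
      ring_nf
    · rw [hΦ, hcoef, hfour]
      simp
  have h1 := h0.sub (hasSum_ite_eq 0 (A 0 / 2))
  rw [add_sub_cancel_right] at h1
  refine h1.congr_fun fun m => ?_
  rcases eq_or_ne m 0 with rfl | hm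
  · simp
    ring
  · simp [hm]

/-! ### Aliasing on the Chebyshev nodes -/

/-- The mean of `cos (p θ)` over the angles `θ` of the `n` Chebyshev nodes. -/
noncomputable def nodeMean (n : ℕ) (p : ℤ) : ℝ :=
  1 / (n : ℝ) * ∑ l ∈ Finset.Icc 1 n, Real.cos (p * ((2 * (l : ℝ) - 1) * Real.pi / (2 * (n : ℝ))))

theorem nodeMean_zero {n : ℕ} (hn : n ≠ 0) : nodeMean n 0 = 1 := by
  have : (n : ℝ) ≠ 0 := by exact_mod_cast hn
  simp [nodeMean, this]

theorem abs_nodeMean_le_one (n : ℕ) (p : ℤ) : |nodeMean n p| ≤ 1 := by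
  rcases eq_or_ne n 0 with rfl | hn
  · simp [nodeMean]
  have hn' : (0 : ℝ) < n := by positivity
  rw [nodeMean, abs_mul, abs_of_pos (by positivity), one_div, inv_mul_le_iff₀ hn', mul_one]
  refine (Finset.abs_sum_le_sum_abs _ _).trans ?_
  refine (Finset.sum_le_card_nsmul _ _ 1 fun l _ => Real.abs_cos_le_one _).trans ?_
  simp

theorem nodeMean_eq_zero {n : ℕ} {p : ℤ} (hp : ¬ (2 * n : ℤ) ∣ p) : nodeMean n p = 0 := by
  rcases eq_or_ne n 0 with rfl | hn
  · simp [nodeMean]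
  have h := Polynomial.Chebyshev.sumZeroes_T_of_not_dvd hp
  have hn' : (n : ℝ) ≠ 0 := by exact_mod_cast hn
  rw [Polynomial.Chebyshev.sumZeroes, mul_eq_zero, or_iff_right (by positivity)] at h
  rw [nodeMean, mul_eq_zero]
  right
  rw [← h, Finset.range_eq_Ico, ← Finset.sum_Ico_add_right_sub_eq (c := 1)]
  refine Finset.sum_congr (by ext; simp) fun l hl => ?_
  rw [Polynomial.Chebyshev.T_real_cos]
  have hl1 : 1 ≤ l := by simp at hl; omega
  push_cast [Nat.cast_sub hl1]
  congr 1
  field_simp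
  ring

/-- At most one integer of a window shorter than `2 n` is congruent to `m` modulo `2 n`. -/
theorem sum_abs_nodeMean_le_one {n : ℕ} (m : ℤ) (s : Finset ℤ)
    (hs : ∀ i ∈ s, ∀ j ∈ s, i - j < 2 * n) : ∑ j ∈ s, |nodeMean n (m - j)| ≤ 1 := by
  classical
  by_cases h : ∃ j ∈ s, (2 * n : ℤ) ∣ m - j
  · obtain ⟨j, hj, hd⟩ := h
    rw [Finset.sum_eq_single_of_mem j hj]
    · exact abs_nodeMean_le_one _ _
    · intro i hi hij
      rw [nodeMean_eq_zero, abs_zero]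
      intro hd'
      have h1 : (2 * n : ℤ) ∣ i - j := by
        have := dvd_sub hd hd'
        rwa [sub_sub_sub_cancel_left] at this
      refine hij (sub_eq_zero.mp (Int.eq_zero_of_abs_lt_dvd h1 ?_))
      rw [abs_lt]
      have := hs i hi j hj
      have := hs j hj i hi
      constructor <;> linarith
  · push Not at h
    rw [Finset.sum_eq_zero]
    · exact zero_le_one
    · intro j hj
      rw [nodeMean_eq_zero (h j hj), abs_zero]

theorem sum_Icc_neg_eq (d : ℕ) (h : ℤ → ℝ) :
    ∑ j ∈ Finset.Icc (-d : ℤ) d, h j = h 0 + ∑ j ∈ Finset.Icc 1 d, (h j + h (-j)) := by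
  induction d with
  | zero => simp
  | succ d ih =>
    have e : Finset.Icc (-(d + 1 : ℕ) : ℤ) (d + 1 : ℕ) =
        insert (-(d + 1 : ℕ) : ℤ) (insert ((d + 1 : ℕ) : ℤ) (Finset.Icc (-d : ℤ) d)) := by
      ext; simp; omega
    rw [e, Finset.sum_insert, Finset.sum_insert, ih, Finset.sum_Icc_succ_top (by omega)]
    · ring
    · simp
    · simp; omega

/-- The error, at angle `θ`, of the discrete Chebyshev sum of degree `d` on `n` nodes applied to
`T_m`: on the nodes `T_m` is indistinguishable from the `T_j` with `j ≡ ± m` modulo `2 n`. -/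
noncomputable def aliasError (n d m : ℕ) (θ : ℝ) : ℝ :=
  Real.cos (m * θ) - ∑ j ∈ Finset.Icc (-d : ℤ) d, nodeMean n (m - j) * Real.cos (j * θ)

theorem aliasError_eq_zero {n d m : ℕ} (hmd : m ≤ d) (hmn : m + d < 2 * n) (θ : ℝ) :
    aliasError n d m θ = 0 := by
  rw [aliasError, Finset.sum_eq_single_of_mem (m : ℤ) (by simp; omega)]
  · rw [sub_self, nodeMean_zero (by omega)]
    simp
  · intro j hj hjm
    rw [nodeMean_eq_zero, zero_mul]
    intro hd
    rw [Finset.mem_Icc] at hj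
    refine hjm (sub_eq_zero.mp (Int.eq_zero_of_abs_lt_dvd hd ?_)).symm
    rw [abs_lt]
    constructor <;> omega

theorem abs_sum_nodeMean_mul_cos_le (n m : ℕ) (s : Finset ℤ) (θ : ℝ) :
    |∑ j ∈ s, nodeMean n (m - j) * Real.cos (j * θ)| ≤ ∑ j ∈ s, |nodeMean n (m - j)| := by
  refine (Finset.abs_sum_le_sum_abs _ _).trans (Finset.sum_le_sum fun j _ => ?_)
  rw [abs_mul]
  exact mul_le_of_le_one_right (abs_nonneg _) (Real.abs_cos_le_one _)

theorem abs_aliasError_le_two {n d : ℕ} (hd : d < n) (m : ℕ) (θ : ℝ) :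
    |aliasError n d m θ| ≤ 2 := by
  have h1 := abs_sum_nodeMean_mul_cos_le n m (Finset.Icc (-d : ℤ) d) θ
  have h2 := sum_abs_nodeMean_le_one (n := n) m (Finset.Icc (-d : ℤ) d) (by
    intro i hi j hj
    rw [Finset.mem_Icc] at hi hj
    omega)
  have h3 := abs_sub (Real.cos (m * θ))
    (∑ j ∈ Finset.Icc (-d : ℤ) d, nodeMean n (m - j) * Real.cos (j * θ))
  have h4 := Real.abs_cos_le_one (m * θ)
  rw [aliasError]
  linarith

theorem abs_aliasError_le_three {n d : ℕ} (hd : d < 2 * n) (m : ℕ) (θ : ℝ) :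
    |aliasError n d m θ| ≤ 3 := by
  have h1 := abs_sum_nodeMean_mul_cos_le n m (Finset.Icc (-d : ℤ) d) θ
  have h2 := sum_abs_nodeMean_le_one (n := n) m (Finset.Icc (-d : ℤ) (-1)) (by
    intro i hi j hj
    rw [Finset.mem_Icc] at hi hj
    omega)
  -- The window `[-d, d]` is cut at `0`: each half is shorter than one period `2 n`.
  have h2' := sum_abs_nodeMean_le_one (n := n) m (Finset.Icc (0 : ℤ) d) (by
    intro i hi j hj
    rw [Finset.mem_Icc] at hi hj
    omega)
  have h5 : ∑ j ∈ Finset.Icc (-d : ℤ) d, |nodeMean n (m - j)| =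
      ∑ j ∈ Finset.Icc (-d : ℤ) (-1), |nodeMean n (m - j)| +
      ∑ j ∈ Finset.Icc (0 : ℤ) d, |nodeMean n (m - j)| := by
    rw [← Finset.sum_union]
    · congr 1
      ext; simp; omega
    · rw [Finset.disjoint_left]
      intro i hi hj
      rw [Finset.mem_Icc] at hi hj
      omega
  have h3 := abs_sub (Real.cos (m * θ))
    (∑ j ∈ Finset.Icc (-d : ℤ) d, nodeMean n (m - j) * Real.cos (j * θ))
  have h4 := Real.abs_cos_le_one (m * θ)
  rw [aliasError]
  linarith

/-- The right-hand side is the discrete Chebyshev sum of `T_m`, at angle `θ`. -/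
theorem sum_nodeMean_mul_cos (n d m : ℕ) (θ : ℝ) :
    ∑ j ∈ Finset.Icc (-d : ℤ) d, nodeMean n (m - j) * Real.cos (j * θ) =
      1 / (n : ℝ) * ∑ l ∈ Finset.Icc 1 n,
        Real.cos (m * ((2 * (l : ℝ) - 1) * Real.pi / (2 * (n : ℝ)))) * (1 + ∑ j ∈ Finset.Icc 1 d,
          2 * Real.cos (j * ((2 * (l : ℝ) - 1) * Real.pi / (2 * (n : ℝ)))) *
            Real.cos (j * θ)) := by
  simp only [nodeMean, Finset.mul_sum, Finset.sum_mul]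
  rw [Finset.sum_comm]
  refine Finset.sum_congr rfl fun l _ => ?_
  rw [sum_Icc_neg_eq, mul_add, mul_add, Finset.mul_sum, Finset.mul_sum]
  congr 1
  · simp
  · refine Finset.sum_congr rfl fun j _ => ?_
    push_cast
    rw [sub_neg_eq_add, neg_mul, Real.cos_neg, sub_mul (m : ℝ), add_mul (m : ℝ), Real.cos_sub,
      Real.cos_add]
    ring

/-- The discrete Chebyshev sum as a linear combination of the values of `f` at the nodes. -/
theorem chebPartialSumApprox_chebMap_cos {a b : ℝ} (hab : a < b) (f : ℝ → ℝ) (d n : ℕ) (θ : ℝ) :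
    chebPartialSumApprox f a b d n (chebMap a b (Real.cos θ)) =
      1 / (n : ℝ) * ∑ l ∈ Finset.Icc 1 n, f (chebMap a b (chebNode n l)) *
        (1 + ∑ j ∈ Finset.Icc 1 d,
          2 * Real.cos (j * ((2 * (l : ℝ) - 1) * Real.pi / (2 * (n : ℝ)))) * Real.cos (j * θ)) := by
  have hinv : chebMapInv a b (chebMap a b (Real.cos θ)) = Real.cos θ :=
    (chebMap_invOn hab).1.1 ⟨Real.neg_one_le_cos θ, Real.cos_le_one θ⟩
  simp only [chebPartialSumApprox, chebCoeffApprox, hinv, chebNode,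
    Polynomial.Chebyshev.T_real_cos, Int.cast_natCast, Finset.mul_sum, mul_add, Finset.sum_mul,
    Finset.sum_add_distrib, Finset.sum_div]
  congr 1
  · refine Finset.sum_congr rfl fun l _ => ?_
    simp
    ring
  · rw [Finset.sum_comm]
    refine Finset.sum_congr rfl fun l _ => Finset.sum_congr rfl fun j _ => ?_
    ring

/-- Termwise error formula: if the Chebyshev series of `f` converges pointwise, the error of the
discrete Chebyshev sum is the same series with every `T_m` replaced by its own error. -/
theorem hasSum_mul_aliasError {a b : ℝ} (hab : a < b) {f : ℝ → ℝ} {α : ℕ → ℝ}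
    (hf : ∀ θ : ℝ, HasSum (fun m : ℕ => α m * Real.cos (m * θ)) (f (chebMap a b (Real.cos θ))))
    (d n : ℕ) (θ : ℝ) :
    HasSum (fun m : ℕ => α m * aliasError n d m θ)
      (f (chebMap a b (Real.cos θ)) -
        chebPartialSumApprox f a b d n (chebMap a b (Real.cos θ))) := by
  rw [chebPartialSumApprox_chebMap_cos hab]
  have h := (hf θ).sub ((hasSum_sum fun l (_ : l ∈ Finset.Icc 1 n) =>
    (hf ((2 * (l : ℝ) - 1) * Real.pi / (2 * (n : ℝ)))).mul_right
      (1 + ∑ j ∈ Finset.Icc 1 d, 2 * Real.cos (j * ((2 * (l : ℝ) - 1) * Real.pi / (2 * (n : ℝ)))) *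
        Real.cos (j * θ))).mul_left (1 / (n : ℝ)))
  refine h.congr_fun fun m => ?_
  rw [aliasError, sum_nodeMean_mul_cos, mul_sub, Finset.mul_sum, Finset.mul_sum, Finset.mul_sum]
  congr 1
  refine Finset.sum_congr rfl fun l _ => ?_
  ring

/-! ### The error bound -/

/-- Pointwise convergence of the Chebyshev series of a continuous function on `[a, b]`. -/
theorem hasSum_chebCoeff_mul_cos {a b : ℝ} (hab : a < b) {f : ℝ → ℝ}
    (hf : ContinuousOn f (Icc a b)) (hsum : Summable (chebCoeff f a b)) (θ : ℝ) :
    HasSum (fun m : ℕ => (if m = 0 then chebCoeff f a b 0 / 2 else chebCoeff f a b m) *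
      Real.cos (m * θ)) (f (chebMap a b (Real.cos θ))) :=
  hasSum_cos_series (F := fun θ => f (chebMap a b (Real.cos θ)))
    (hf.comp_continuous (continuous_chebMap_cos a b) (chebMap_cos_mem_Icc hab))
    (fun x => by simp only [Real.cos_add_two_pi]) (fun x => by simp only [Real.cos_neg])
    (fun _ => rfl) hsum θ

theorem summable_chebCoeff {a b : ℝ} {f : ℝ → ℝ} {k : ℕ} (hk : 1 ≤ k) {C : ℝ}
    (hdec : ∀ m : ℕ, k < m → |chebCoeff f a b m| ≤ C * (1 / stepProd (k + 1) m)) :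
    Summable (chebCoeff f a b) := by
  have hpos : ∀ i : ℕ, 0 ≤ 1 / stepProd (k + 1) ((k : ℝ) + 1 + i) := fun i =>
    one_div_nonneg.mpr (stepProd_pos (by
      push_cast
      have : (0 : ℝ) ≤ i := i.cast_nonneg
      linarith)).le
  have h1 : Summable fun i : ℕ => 1 / stepProd (k + 1) ((k : ℝ) + 1 + i) :=
    summable_of_sum_range_le hpos fun N => sum_range_inv_stepProd_le hk le_rfl N
  rw [← summable_nat_add_iff (k + 1)]
  refine Summable.of_norm_bounded (h1.mul_left C) fun i => ?_
  have h2 := hdec (i + (k + 1)) (by omega)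
  have e : ((i + (k + 1) : ℕ) : ℝ) = (k : ℝ) + 1 + i := by push_cast; ring
  rwa [e] at h2

/-- If the discrete Chebyshev sum reproduces `T_0, …, T_D` and its error on every `T_m` is at most
`K`, then its error on `f` is at most `K` times the tail of the coefficient bounds beyond `D`. -/
theorem abs_sub_chebPartialSumApprox_le {a b : ℝ} (hab : a < b) {f : ℝ → ℝ}
    (hf : ContinuousOn f (Icc a b)) {k : ℕ} (hk : 1 ≤ k) {C : ℝ} (hC : 0 ≤ C)
    (hdec : ∀ m : ℕ, k < m → |chebCoeff f a b m| ≤ C * (1 / stepProd (k + 1) m))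
    {n d D : ℕ} (hkD : k ≤ D) {K : ℝ} (hzero : ∀ m ≤ D, ∀ θ, aliasError n d m θ = 0)
    (hK : ∀ m θ, |aliasError n d m θ| ≤ K) {x : ℝ} (hx : x ∈ Icc a b) :
    |f x - chebPartialSumApprox f a b d n x| ≤
      K * (C * (1 / (2 * k) * (1 / stepProd k D + 1 / stepProd k ((D : ℝ) + 1)))) := by
  have hK0 : 0 ≤ K := (abs_nonneg _).trans (hK 0 0)
  obtain ⟨t, ht, rfl⟩ := (chebMap_invOn hab).2.surjOn hx
  obtain ⟨θ, -, rfl⟩ := Real.bijOn_cos.surjOn ht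
  have h := hasSum_mul_aliasError hab
    (hasSum_chebCoeff_mul_cos hab hf (summable_chebCoeff hk hdec)) d n θ
  rw [← hasSum_nat_add_iff' (D + 1), Finset.sum_eq_zero (fun m hm => by
    rw [hzero m (Nat.lt_succ_iff.mp (Finset.mem_range.mp hm)), mul_zero]), sub_zero] at h
  refine le_of_tendsto' h.tendsto_sum_nat.abs fun N => ?_
  calc _ ≤ ∑ i ∈ Finset.range N, K * (C * (1 / stepProd (k + 1) ((D : ℝ) + 1 + i))) := by
        refine (Finset.abs_sum_le_sum_abs _ _).trans (Finset.sum_le_sum fun i _ => ?_)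
        have h1 := hdec (i + (D + 1)) (by omega)
        have e : ((i + (D + 1) : ℕ) : ℝ) = (D : ℝ) + 1 + i := by push_cast; ring
        rw [e] at h1
        rw [abs_mul, if_neg (by omega), mul_comm K]
        exact mul_le_mul h1 (hK _ _) (abs_nonneg _) ((abs_nonneg _).trans h1)
    _ = K * (C * ∑ i ∈ Finset.range N, 1 / stepProd (k + 1) ((D : ℝ) + 1 + i)) := by
        rw [Finset.mul_sum, Finset.mul_sum]
    _ ≤ _ := by
        gcongr
        exact sum_range_inv_stepProd_le hk (by exact_mod_cast hkD) N

theorem eLpNorm_one_restrict_Icc_le {a b M : ℝ} {e : ℝ → ℝ}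
    (h : ∀ x ∈ Icc a b, |e x| ≤ M) :
    eLpNorm e 1 (volume.restrict (Icc a b)) ≤ ENNReal.ofReal ((b - a) * M) := by
  rcases lt_or_ge b a with hab | hab
  · simp [Icc_eq_empty hab.not_ge]
  rw [eLpNorm_one_eq_lintegral_enorm]
  calc _ ≤ ∫⁻ _ in Icc a b, ENNReal.ofReal M := by
        refine setLIntegral_mono measurable_const fun x hx => ?_
        rw [Real.enorm_eq_ofReal_abs]
        exact ENNReal.ofReal_le_ofReal (h x hx)
    _ = _ := by
        rw [setLIntegral_const, Real.volume_Icc, mul_comm,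
          ← ENNReal.ofReal_mul (sub_nonneg.mpr hab)]

/-- Coefficient decay for a function whose derivatives are absolutely continuous up to order
`k - 1` and whose `k`-th derivative has a version `g` of bounded variation. -/
theorem abs_chebCoeff_le_of_absolutelyContinuous {a b : ℝ} (hab : a < b) {k : ℕ} {f g : ℝ → ℝ}
    (hk : 1 ≤ k)
    (hf : ∀ i < k, AbsolutelyContinuousOnInterval (iteratedDerivWithin i f (Icc a b)) a b)
    (hg : g =ᵐ[volume.restrict (Icc a b)] iteratedDerivWithin k f (Icc a b))
    (hbv : BoundedVariationOn g (Icc a b)) {m : ℕ} (hm : k < m) :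
    |chebCoeff f a b m| ≤ 2 / Real.pi * ((b - a) / 2) ^ k *
      (eVariationOn g (Icc a b)).toReal * (1 / stepProd (k + 1) m) := by
  -- The chain `f, f', …, f^{(k-1)}, g`.
  set v : ℕ → ℝ → ℝ := fun i => if i < k then iteratedDerivWithin i f (Icc a b) else g with hv
  have hvi : ∀ i < k, v i = iteratedDerivWithin i f (Icc a b) := fun i hi => if_pos hi
  have hvk : v k = g := if_neg (lt_irrefl k)
  have hv0 : v 0 = f := by rw [hvi 0 hk, iteratedDerivWithin_zero]
  have hc : ∀ i < k, ContinuousOn (v i) (Icc a b) := fun i hi => by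
    have := (hf i hi).continuousOn
    rwa [uIcc_of_le hab.le, ← hvi i hi] at this
  have hae : ∀ i < k, v (i + 1) =ᵐ[volume.restrict (Icc a b)] derivWithin (v i) (Icc a b) := by
    intro i hi
    rw [hvi i hi, ← iteratedDerivWithin_succ]
    rcases (Nat.succ_le_of_lt hi).lt_or_eq with h | h
    · rw [hvi (i + 1) h]
    · rw [show i + 1 = k from h, hvk]
      exact hg
  have hac : ∀ i < k, AbsolutelyContinuousOnInterval (v i) a b := fun i hi => by
    rw [hvi i hi]
    exact hf i hi
  have hd : ∀ i < k, ∃ s : Set ℝ, s.Countable ∧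
      ∀ x ∈ Ioo a b \ s, HasDerivAt (v i) (v (i + 1) x) x := by
    intro i hi
    refine ⟨{x ∈ Ioo a b | ¬ ContinuousAt (v (i + 1)) x}, ?_, fun x hx =>
      (hac i hi).hasDerivAt_of_continuousAt (hae i hi) hx.1
        (by_contra fun h => hx.2 ⟨hx.1, h⟩)⟩
    rcases (Nat.succ_le_of_lt hi).lt_or_eq with h | h
    -- Below the top order the derivative is continuous, so nothing is excluded; at the top order
    -- the exceptional set is that of the discontinuities of `g`.
    · refine countable_empty.mono fun x hx => hx.2 ?_
      exact (hc (i + 1) h).continuousAt (Icc_mem_nhds hx.1.1 hx.1.2)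
    · rw [show i + 1 = k from h, hvk]
      exact hbv.countable_not_continuousAt
  have := abs_chebCoeff_le hab k v hc hd (hvk ▸ hbv) hm
  rwa [hv0, hvk] at this

theorem mainTheorem1 (a b : ℝ) (hab : a < b) (k : ℕ) (hk : 1 ≤ k) (f : ℝ → ℝ)
    -- `f, f', …, f^{(k-1)}` are absolutely continuous on `[a,b]`
    (hf : ∀ i < k, AbsolutelyContinuousOnInterval (iteratedDerivWithin i f (Icc a b)) a b)
    -- `g` is a version of the almost everywhere defined derivative `f^{(k)}`
    (g : ℝ → ℝ)
    (hg : g =ᵐ[volume.restrict (Icc a b)] iteratedDerivWithin k f (Icc a b))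
    (hbv : BoundedVariationOn g (Icc a b))
    (V : ℝ) (hV : V = (eVariationOn g (Icc a b)).toReal)
    (d n : ℕ) (hkn : k ≤ n) (hkd : k ≤ d) (hdn : d + k + 1 ≤ 2 * n) :
    (∀ l : ℕ, 1 ≤ l → l + k ≤ n → (d : ℤ) = (n : ℤ) - (l : ℤ) →
      eLpNorm (fun x => f x - chebPartialSumApprox f a b d n x) 1 (volume.restrict (Icc a b)) ≤
        ENNReal.ofReal (4 * V * (b - a) ^ (k + 1) / (4 ^ k * (k : ℝ) * Real.pi) *
          ∑ j ∈ Finset.range (k + 1), (k.choose j : ℝ) *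
            (1 / ∏ r ∈ Finset.range k, ((n : ℝ) - (l : ℝ) + (j : ℝ) - (r : ℝ))))) ∧
    (∀ l : ℕ, l + k + 1 ≤ n → d = n + l →
      eLpNorm (fun x => f x - chebPartialSumApprox f a b d n x) 1 (volume.restrict (Icc a b)) ≤
        ENNReal.ofReal (6 * V * (b - a) ^ (k + 1) / (4 ^ k * (k : ℝ) * Real.pi) *
          ∑ j ∈ Finset.range (k + 1), (k.choose j : ℝ) *
            (1 / ∏ r ∈ Finset.range k, ((n : ℝ) - (l : ℝ) + (j : ℝ) - 1 - (r : ℝ))))) := by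
  have hba : 0 < b - a := sub_pos.mpr hab
  have hk0 : (0 : ℝ) < k := by exact_mod_cast hk
  have hV0 : 0 ≤ V := hV ▸ ENNReal.toReal_nonneg
  have hcont : ContinuousOn f (Icc a b) := by
    have := (hf 0 hk).continuousOn
    rwa [iteratedDerivWithin_zero, uIcc_of_le hab.le] at this
  have hdec : ∀ m : ℕ, k < m → |chebCoeff f a b m| ≤
      2 / Real.pi * ((b - a) / 2) ^ k * V * (1 / stepProd (k + 1) m) := fun m hm =>
    hV ▸ abs_chebCoeff_le_of_absolutelyContinuous hab hk hf hg hbv hm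
  -- Both bounds, with `D` the last index up to which `T_m` is reproduced exactly.
  have main : ∀ (D : ℕ) (K : ℝ), k ≤ D → (∀ m ≤ D, ∀ θ, aliasError n d m θ = 0) →
      (∀ m θ, |aliasError n d m θ| ≤ K) →
      eLpNorm (fun x => f x - chebPartialSumApprox f a b d n x) 1 (volume.restrict (Icc a b)) ≤
        ENNReal.ofReal (2 * K * V * (b - a) ^ (k + 1) / (4 ^ k * (k : ℝ) * Real.pi) *
          ∑ j ∈ Finset.range (k + 1), (k.choose j : ℝ) *
            (1 / ∏ r ∈ Finset.range k, ((D : ℝ) + (j : ℝ) - (r : ℝ)))) := by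
    intro D K hkD hzero hK
    refine (eLpNorm_one_restrict_Icc_le fun x hx => abs_sub_chebPartialSumApprox_le hab hcont hk
      (by positivity) hdec hkD hzero hK hx).trans_eq ?_
    rw [sum_choose_div_prod_eq_add hk (by exact_mod_cast hkD)]
    congr 1
    have h4 : (4 : ℝ) ^ k = 2 ^ k * 2 ^ k := by rw [← mul_pow]; norm_num
    rw [h4, div_pow]
    field_simp
    ring
  constructor
  · intro l hl hlk hd
    have hdl : d + l = n := by omega
    have h := main d 2 hkd (fun m hm θ => aliasError_eq_zero hm (by omega) θ)
      (fun m θ => abs_aliasError_le_two (by omega) m θ)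
    have e : (d : ℝ) = (n : ℝ) - l := by rw [← hdl]; push_cast; ring
    rw [e, show (2 : ℝ) * 2 = 4 by norm_num] at h
    exact h
  · intro l hlk hd
    -- The smallest `m` with an alias in the window is `2 n - d`, so `D = 2 n - d - 1 = n - l - 1`.
    have h := main (2 * n - d - 1) 3 (by omega)
      (fun m hm θ => aliasError_eq_zero (by omega) (by omega) θ)
      (fun m θ => abs_aliasError_le_three (by omega) m θ)
    have e : ((2 * n - d - 1 : ℕ) : ℝ) = (n : ℝ) - l - 1 := by
      rw [show 2 * n - d - 1 = n - (l + 1) by omega, Nat.cast_sub (by omega)]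
      push_cast
      ring
    have e' : ∀ j : ℕ, (n : ℝ) - l - 1 + j = (n : ℝ) - l + j - 1 := fun j => by ring
    rw [e, show (2 : ℝ) * 3 = 6 by norm_num] at h
    simpa only [e'] using h
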